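/- Let $X$ be a separable, infinite-dimensional (real or complex) Banach space and let $\mathcal{B}(X)$ be the algebra of bounded linear operators on $X$. For $M \ge 1$ and $S_1,\dots,S_M \in \mathcal{B}(X)$, let $$\mathrm{s}\text{-}\mathcal{HC}(S_1,\dots,S_M) = \Bigl\{ f \in X : \{(x,\dots,x) : x \in X\} \subseteq \overline{\{(S_1^n f,\dots,S_M^n f) : n \in \mathbb{N}\}} \Bigr\},$$ where the closure is taken in the product space $X^M$ and $\mathbb{N}=\{0,1,2,\dots\}$; its elements are the simultaneously hypercyclic (s-hypercyclic) vectors of $S_1,\dots,S_M$, and $S_1,\dots,S_M$ are called s-hypercyclic if this set is nonempty. Let $N \ge 1$, let $T_1,\dots,T_N \in \mathcal{B}(X)$ be s-hypercyclic, and let $\mathcal{A} \subseteq \mathrm{s}\text{-}\mathcal{HC}(T_1,\dots,T_N)$ be a countable (possibly finite) and linearly independent set. Then $$\{ T \in \mathcal{B}(X) : \mathcal{A} \subseteq \mathrm{s}\text{-}\mathcal{HC}(T_1,\dots,T_N,T) \}$$ is dense in $\mathcal{B}(X)$ for the strong operator topology, i.e. the topology of pointwise convergence in norm on $X$. -/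

import Mathlib

/-- The set `s-HC(T₁, …, T_N)` of simultaneously hypercyclic vectors of a family of bounded
operators: the vectors `f` for which the closure, in the product topology of `X^N`, of the joint
orbit `{(T₁ⁿ f, …, T_Nⁿ f) : n ∈ ℕ}` contains the diagonal `{(x, …, x) : x ∈ X}`. -/
def sHC {𝕜 X : Type*} [NontriviallyNormedField 𝕜] [NormedAddCommGroup X] [NormedSpace 𝕜 X]
    {N : ℕ} (T : Fin N → X →L[𝕜] X) : Set X :=
  {f | Set.range (fun x : X => fun _ : Fin N => x) ⊆
    closure (Set.range (fun n : ℕ => fun i : Fin N => (T i ^ n) f))}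

/-- The operators `T₁, …, T_N` are simultaneously hypercyclic if they have an s-hypercyclic
vector. -/
def IsSHypercyclic {𝕜 X : Type*} [NontriviallyNormedField 𝕜] [NormedAddCommGroup X]
    [NormedSpace 𝕜 X] {N : ℕ} (T : Fin N → X →L[𝕜] X) : Prop :=
  (sHC T).Nonempty

/-- A set of bounded operators is SOT-dense if its image in the space of continuous linear maps
with the topology of pointwise convergence in norm (the strong operator topology) is dense. -/
def IsSOTDense {𝕜 X : Type*} [NontriviallyNormedField 𝕜] [NormedAddCommGroup X]
    [NormedSpace 𝕜 X] (S : Set (X →L[𝕜] X)) : Prop :=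
  Dense (ContinuousLinearMap.toPointwiseConvergenceCLM 𝕜 (RingHom.id 𝕜) X X '' S)

/-!
Fix `S` and an s-hypercyclic vector `f ≠ 0` of `T₁, …, T_N`. For invertible `L`, the vector `f` is
s-hypercyclic for `T₁, …, T_N, L⁻¹ S L` as soon as the orbits of `f` under the `Tᵢ` and of `L f`
under `S` jointly approach `(x, …, x, L x)` for all `x`. The orbit of `f` returns to any
neighbourhood of `(x, …, x)` infinitely often; if `S` is topologically mixing, one such return time
`n` admits a rank-one perturbation of `L` that moves `L f` to a nearby point `w` with `Sⁿ w` close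
to `L x`. By Baire category a generic `L` therefore serves all `f ∈ A` and all `x` at once, and the
resulting operators `L⁻¹ S L` are norm-dense in the similarity orbit of `S`.

It remains to find a mixing `S` whose similarity orbit is dense for the strong operator topology.
Conjugates of `S` can be prescribed on finitely many vectors up to a small perturbation once there
is a sequence `u` such that the vectors `u k`, `S (u k) - u k` are all linearly independent. Such
an `S` is obtained from the translation `p(X) ↦ p(X + 1)` of polynomials: the monomials are sent to
multiples of a biorthogonal sequence, growing so fast that the degree-lowering operator
`p(X) ↦ p(X + 1) - p(X)` becomes nuclear.
-/

open Filter Topology Polynomial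

section Biorthogonal

variable {𝕜 E F : Type*} [RCLike 𝕜] [NormedAddCommGroup E] [NormedSpace 𝕜 E]

theorem exists_clm_apply_eq [AddCommMonoid F] [Module 𝕜 F] [TopologicalSpace F]
    [ContinuousAdd F] [ContinuousSMul 𝕜 F] {ι : Type*} [Finite ι] {a : ι → E}
    (ha : LinearIndependent 𝕜 a) (b : ι → F) : ∃ A : E →L[𝕜] F, ∀ i, A (a i) = b i := by
  classical
  have := Fintype.ofFinite ι
  have hdual : ∀ c : ι → 𝕜, ∃ φ : E →L[𝕜] 𝕜, ∀ i, φ (a i) = c i := fun c => by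
    obtain ⟨φ, hφ⟩ := (SeparatingDual.dualMap_surjective_iff (V := E)
      (f := Fintype.linearCombination 𝕜 a)).2 ha.fintypeLinearCombination_injective
      (Fintype.linearCombination 𝕜 c)
    exact ⟨φ, fun i => by simpa using LinearMap.congr_fun hφ (Pi.single i 1)⟩
  choose φ hφ using fun i => hdual (Pi.single i 1)
  refine ⟨∑ i, (φ i).smulRight (b i), fun j => ?_⟩
  simp [hφ, Pi.single_apply]

/-- The triangular recursion that turns `v` into a sequence biorthogonal to `f`, provided that
`f k` vanishes on `v j` for `j < k` and takes the value `1` at `v k`. -/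
noncomputable def biorthogonalize {R M : Type*} [Ring R] [AddCommGroup M] [Module R M]
    (f : ℕ → M →ₗ[R] R) (v : ℕ → M) : ℕ → M
  | k => v k - ∑ j : Fin k, f j (v k) • biorthogonalize f v j

theorem apply_biorthogonalize {R M : Type*} [Ring R] [AddCommGroup M] [Module R M]
    {f : ℕ → M →ₗ[R] R} {v : ℕ → M} (hlt : ∀ k, ∀ j < k, f k (v j) = 0)
    (hself : ∀ k, f k (v k) = 1) (i k : ℕ) :
    f i (biorthogonalize f v k) = if i = k then 1 else 0 := by
  induction k using Nat.strong_induction_on with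
  | _ k ih =>
    have hsum : ∑ j : Fin k, f j (v k) * f i (biorthogonalize f v j) =
        if i < k then f i (v k) else 0 := by
      simp_rw [fun j : Fin k => ih j j.2]
      rw [Fin.sum_univ_eq_sum_range (fun j => f j (v k) * if i = j then 1 else 0)]
      simp
    rw [biorthogonalize, map_sub, map_sum]
    simp only [map_smul, smul_eq_mul, hsum]
    rcases lt_trichotomy i k with h | rfl | h
    · simp [h, h.ne]
    · simp [hself]
    · simp [h.not_gt, h.ne', hlt i k h]

theorem span_range_le_span_range_biorthogonalize {R M : Type*} [Ring R] [AddCommGroup M]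
    [Module R M] (f : ℕ → M →ₗ[R] R) (v : ℕ → M) :
    Submodule.span R (Set.range v) ≤ Submodule.span R (Set.range (biorthogonalize f v)) := by
  refine Submodule.span_le.2 (Set.range_subset_iff.2 fun k => ?_)
  have hv : v k = biorthogonalize f v k + ∑ j : Fin k, f j (v k) • biorthogonalize f v j := by
    conv_rhs => enter [1]; rw [biorthogonalize]
    exact (sub_add_cancel _ _).symm
  have hmem : ∀ j, biorthogonalize f v j ∈ Submodule.span R (Set.range (biorthogonalize f v)) :=
    fun j => Submodule.subset_span ⟨j, rfl⟩
  rw [hv]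
  exact add_mem (hmem k) (sum_mem fun j _ => Submodule.smul_mem _ _ (hmem j))

theorem exists_linearIndependent_seq_dense_span [TopologicalSpace.SeparableSpace E]
    (hE : ¬ FiniteDimensional 𝕜 E) :
    ∃ v : ℕ → E, LinearIndependent 𝕜 v ∧ Dense (Submodule.span 𝕜 (Set.range v) : Set E) := by
  obtain ⟨b, hb, hspan, hli⟩ :=
    exists_linearIndependent 𝕜 (Set.range (TopologicalSpace.denseSeq E))
  have hd : Dense (Submodule.span 𝕜 b : Set E) := by
    rw [hspan]
    exact (TopologicalSpace.denseRange_denseSeq E).mono Submodule.subset_span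
  have hinf : b.Infinite := fun hfin => by
    have : FiniteDimensional 𝕜 (Submodule.span 𝕜 b) := .span_of_finite 𝕜 hfin
    have htop : Submodule.span 𝕜 b = ⊤ := SetLike.coe_injective <| by
      rw [← (Submodule.span 𝕜 b).closed_of_finiteDimensional.closure_eq, hd.closure_eq,
        Submodule.top_coe]
    exact hE (Module.finite_def.2 (Module.Finite.iff_fg.1 (htop ▸ this)))
  have : Infinite b := hinf.to_subtype
  have : Countable b := ((Set.countable_range _).mono hb).to_subtype
  obtain ⟨g⟩ := nonempty_equiv_of_countable (α := ℕ) (β := b)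
  refine ⟨Subtype.val ∘ g, hli.comp g g.injective, ?_⟩
  rwa [g.surjective.range_comp, Subtype.range_coe]

theorem exists_biorthogonal_seq_dense_span [TopologicalSpace.SeparableSpace E]
    (hE : ¬ FiniteDimensional 𝕜 E) :
    ∃ (f : ℕ → E →L[𝕜] 𝕜) (e : ℕ → E), (∀ i k, f i (e k) = if i = k then 1 else 0) ∧
      Dense (Submodule.span 𝕜 (Set.range e) : Set E) := by
  obtain ⟨v, hv, hd⟩ := exists_linearIndependent_seq_dense_span hE
  choose f hf using fun k => exists_clm_apply_eq
    (hv.comp (Fin.val : Fin (k + 1) → ℕ) Fin.val_injective) (Pi.single (Fin.last k) (1 : 𝕜))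
  have hlt : ∀ k, ∀ j < k, f k (v j) = 0 := fun k j hj => by
    simpa [Fin.ext_iff, hj.ne] using hf k ⟨j, hj.trans k.lt_succ_self⟩
  have hself : ∀ k, f k (v k) = 1 := fun k => by simpa using hf k (Fin.last k)
  exact ⟨f, biorthogonalize (fun k => f k) v, apply_biorthogonalize hlt hself,
    hd.mono (span_range_le_span_range_biorthogonalize _ v)⟩

end Biorthogonal

section DegreeLowering

theorem exists_pos_forall_sum_mul_le {c : ℕ → ℕ → ℝ} (hc : ∀ k j, 0 ≤ c k j) :
    ∃ d : ℕ → ℝ, (∀ k, 0 < d k) ∧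
      ∀ k, ∑ j ∈ Finset.range k, c k j * d j ≤ (1 / 2) ^ k * d k := by
  set r : ℕ → ℝ := fun i => 1 + 2 ^ i * ∑ j ∈ Finset.range i, c i j
  have hsum : ∀ i, 0 ≤ ∑ j ∈ Finset.range i, c i j := fun i => Finset.sum_nonneg fun j _ => hc i j
  have hr : ∀ i, 1 ≤ r i := fun i => le_add_of_nonneg_right (by have := hsum i; positivity)
  set P : ℕ → ℝ := fun k => ∏ i ∈ Finset.range k, r i
  have hP : ∀ k, 0 < P k := fun k => Finset.prod_pos fun i _ => one_pos.trans_le (hr i)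
  have hPmono : Monotone P := monotone_nat_of_le_succ fun k => by
    rw [show P (k + 1) = P k * r k from Finset.prod_range_succ r k]
    exact le_mul_of_one_le_right (hP k).le (hr k)
  refine ⟨fun k => P (k + 1), fun k => hP _, fun k => ?_⟩
  calc ∑ j ∈ Finset.range k, c k j * P (j + 1)
      ≤ ∑ j ∈ Finset.range k, c k j * P k := Finset.sum_le_sum fun j hj =>
        mul_le_mul_of_nonneg_left (hPmono (Finset.mem_range.1 hj)) (hc k j)
    _ = (1 / 2) ^ k * (P k * (2 ^ k * ∑ j ∈ Finset.range k, c k j)) := by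
        rw [← Finset.sum_mul, one_div, inv_pow]
        field_simp
    _ ≤ (1 / 2) ^ k * (P k * r k) := by
        have := (hP k).le
        gcongr
        exact le_add_of_nonneg_left zero_le_one
    _ = (1 / 2) ^ k * P (k + 1) := by rw [← Finset.prod_range_succ r k]

theorem norm_map_le_sum_range_of_degree_lt {𝕜 E : Type*} [NormedField 𝕜] [NormedAddCommGroup E]
    [NormedSpace 𝕜 E] (Φ : 𝕜[X] →ₗ[𝕜] E) {p : 𝕜[X]} {k : ℕ} (hp : p.degree < k) :
    ‖Φ p‖ ≤ ∑ j ∈ Finset.range k, ‖p.coeff j‖ * ‖Φ (X ^ j)‖ := by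
  have hsub : p.support ⊆ Finset.range k := fun j hj => Finset.mem_range.2 <| by
    by_contra! hkj
    exact mem_support_iff.1 hj ((degree_lt_iff_coeff_zero p k).1 hp j hkj)
  calc ‖Φ p‖ = ‖∑ j ∈ p.support, p.coeff j • Φ (X ^ j)‖ := by
        conv_lhs => rw [p.as_sum_support_C_mul_X_pow]
        simp only [← smul_eq_C_mul, map_sum, map_smul]
    _ ≤ ∑ j ∈ p.support, ‖p.coeff j‖ * ‖Φ (X ^ j)‖ :=
        (norm_sum_le _ _).trans_eq (Finset.sum_congr rfl fun j _ => norm_smul _ _)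
    _ ≤ ∑ j ∈ Finset.range k, ‖p.coeff j‖ * ‖Φ (X ^ j)‖ :=
        Finset.sum_le_sum_of_subset_of_nonneg hsub fun j _ _ => by positivity

theorem exists_clm_apply_eq_of_summable {𝕜 E F : Type*} [NontriviallyNormedField 𝕜]
    [NormedAddCommGroup E] [NormedSpace 𝕜 E] [NormedAddCommGroup F] [NormedSpace 𝕜 F]
    [CompleteSpace F] {ι : Type*} [DecidableEq ι] {f : ι → E →L[𝕜] 𝕜} {e : ι → E}
    (hfe : ∀ i k, f i (e k) = if i = k then 1 else 0) {w : ι → F}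
    (hw : Summable fun k => ‖f k‖ * ‖w k‖) : ∃ A : E →L[𝕜] F, ∀ k, A (e k) = w k := by
  have hsum : Summable fun k => (f k).smulRight (w k) :=
    Summable.of_norm (by simpa only [ContinuousLinearMap.norm_smulRight_apply] using hw)
  refine ⟨∑' k, (f k).smulRight (w k), fun k => ?_⟩
  refine (hsum.hasSum.mapL (ContinuousLinearMap.apply 𝕜 F (e k))).unique ?_
  convert hasSum_single k fun j hj => ?_ using 1
  · simp [hfe]
  · simp [hfe, hj]

theorem exists_clm_extending_degree_lowering {𝕜 E : Type*} [RCLike 𝕜] [NormedAddCommGroup E]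
    [NormedSpace 𝕜 E] [CompleteSpace E] [TopologicalSpace.SeparableSpace E]
    (hE : ¬ FiniteDimensional 𝕜 E) {L : 𝕜[X] →ₗ[𝕜] 𝕜[X]} (hL : ∀ k : ℕ, (L (X ^ k)).degree < k) :
    ∃ (Φ : 𝕜[X] →ₗ[𝕜] E) (D : E →L[𝕜] E), Function.Injective Φ ∧ DenseRange Φ ∧
      ∀ p, D (Φ p) = Φ (L p) := by
  obtain ⟨f, e, hfe, he⟩ := exists_biorthogonal_seq_dense_span hE
  obtain ⟨d, hd, hle⟩ := exists_pos_forall_sum_mul_le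
    (c := fun k j => ‖f k‖ * (‖(L (X ^ k)).coeff j‖ * ‖e j‖)) fun k j => by positivity
  have hd0 : ∀ k, (d k : 𝕜) ≠ 0 := fun k => by exact_mod_cast (hd k).ne'
  have hnorm : ∀ k, ‖(d k : 𝕜)‖ = d k := fun k => by simp [abs_of_pos (hd k)]
  set Φ : 𝕜[X] →ₗ[𝕜] E := (basisMonomials 𝕜).constr 𝕜 fun k => (d k : 𝕜) • e k
  have hΦX : ∀ k, Φ (X ^ k) = (d k : 𝕜) • e k := fun k => by
    simpa [X_pow_eq_monomial] using (basisMonomials 𝕜).constr_basis 𝕜 (fun k => (d k : 𝕜) • e k) k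
  have hsum : Summable fun k => ‖f k‖ * ‖(d k : 𝕜)⁻¹ • Φ (L (X ^ k))‖ := by
    refine .of_nonneg_of_le (fun k => by positivity) (fun k => ?_) summable_geometric_two
    rw [norm_smul, norm_inv, hnorm, mul_left_comm, inv_mul_le_iff₀ (hd k), mul_comm (d k)]
    refine le_trans ?_ (hle k)
    refine (mul_le_mul_of_nonneg_left (norm_map_le_sum_range_of_degree_lt Φ (hL k))
      (norm_nonneg _)).trans_eq ?_
    simp only [hΦX, norm_smul, hnorm, Finset.mul_sum]
    exact Finset.sum_congr rfl fun j _ => by ring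
  obtain ⟨D, hD⟩ := exists_clm_apply_eq_of_summable hfe hsum
  have hDX : ∀ k, D (Φ (X ^ k)) = Φ (L (X ^ k)) := fun k => by
    rw [hΦX, map_smul, hD, smul_inv_smul₀ (hd0 k)]
  have he_li : LinearIndependent 𝕜 e := .of_pairwise_dual_eq_zero_one e (fun k => f k)
    (fun i k hik => by simp [hfe, hik]) (by simp [hfe])
  refine ⟨Φ, D, ?_, ?_, fun p => ?_⟩
  · exact (basisMonomials 𝕜).injective_constr_of_linearIndependent
      (he_li.units_smul fun k => Units.mk0 _ (hd0 k))
  · refine he.mono (Submodule.span_le (p := LinearMap.range Φ).2 ?_)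
    exact Set.range_subset_iff.2 fun k =>
      ⟨(d k : 𝕜)⁻¹ • X ^ k, by rw [map_smul, hΦX, inv_smul_smul₀ (hd0 k)]⟩
  · have hcomp : (D : E →ₗ[𝕜] E) ∘ₗ Φ = Φ ∘ₗ L :=
      (basisMonomials 𝕜).ext fun k => by simpa [X_pow_eq_monomial] using hDX k
    exact LinearMap.congr_fun hcomp p

end DegreeLowering

section Mixing

/-- Topological mixing: for nonempty open sets `U` and `V`, all but finitely many iterates of `f`
map some point of `U` into `V`. -/
def IsTopologicallyMixing {α : Type*} [TopologicalSpace α] (f : α → α) : Prop :=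
  ∀ ⦃U V : Set α⦄, IsOpen U → U.Nonempty → IsOpen V → V.Nonempty →
    ∀ᶠ n in atTop, ∃ w ∈ U, f^[n] w ∈ V

/-- The pairs `(u, v)` witnessing mixing of `S` along sequences: some `w n → u` has
`S ^ n (w n) → v`. Mixing follows once these pairs are dense, and being linear they only have to be
exhibited on a spanning set. -/
def mixingPairs {R M : Type*} [Semiring R] [AddCommMonoid M] [Module R M] [TopologicalSpace M]
    [ContinuousAdd M] [ContinuousConstSMul R M] (S : M →L[R] M) : Submodule R (M × M) where
  carrier := {z | ∃ w : ℕ → M, Tendsto w atTop (𝓝 z.1) ∧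
    Tendsto (fun n => (S ^ n) (w n)) atTop (𝓝 z.2)}
  zero_mem' := ⟨0, tendsto_const_nhds, by simpa using tendsto_const_nhds⟩
  add_mem' := by
    rintro _ _ ⟨w, hw, hSw⟩ ⟨w', hw', hSw'⟩
    exact ⟨w + w', hw.add hw', by simpa using hSw.add hSw'⟩
  smul_mem' := by
    rintro c _ ⟨w, hw, hSw⟩
    exact ⟨c • w, hw.const_smul c, by simpa using hSw.const_smul c⟩

theorem isTopologicallyMixing_of_dense_mixingPairs {R M : Type*} [Semiring R] [AddCommMonoid M]
    [Module R M] [TopologicalSpace M] [ContinuousAdd M] [ContinuousConstSMul R M] {S : M →L[R] M}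
    (hS : Dense (mixingPairs S : Set (M × M))) : IsTopologicallyMixing S := by
  intro U V hU hU₀ hV hV₀
  obtain ⟨⟨u, v⟩, ⟨hu, hv⟩, w, hw, hSw⟩ :=
    hS.inter_open_nonempty _ (hU.prod hV) (hU₀.prod hV₀)
  filter_upwards [hw (hU.mem_nhds hu), hSw (hV.mem_nhds hv)] with n hUn hVn
  exact ⟨w n, hUn, by rwa [← FunLike.coe_pow_eq_iterate]⟩

theorem continuous_map_mul_comp_C_mul_X {R M : Type*} [CommSemiring R] [TopologicalSpace R]
    [ContinuousMul R] [AddCommMonoid M] [Module R M] [TopologicalSpace M] [ContinuousAdd M]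
    [ContinuousSMul R M] (Φ : R[X] →ₗ[R] M) (p s : R[X]) :
    Continuous fun t => Φ (p * s.comp (C t * X)) := by
  induction s using Polynomial.induction_on' with
  | add s s' hs hs' => simpa only [add_comp, mul_add, map_add] using! hs.add hs'
  | monomial k a =>
    have hmon : ∀ t, p * (monomial k a).comp (C t * X) = (a * t ^ k) • (p * X ^ k) := fun t => by
      rw [monomial_comp, mul_pow, ← C_pow, smul_eq_C_mul, C_mul]
      ring
    simp only [hmon, map_smul]
    fun_prop

theorem taylor_X_pow_mul_comp {K : Type*} [Field K] {t : K} (ht : t ≠ 0) (i : ℕ) (α β : K) :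
    taylor t (X ^ i * ((X - 1) ^ i * (C α + C β * X)).comp (C t⁻¹ * X)) =
      X ^ i * ((X + 1) ^ i * (C (α + β) + C β * X)).comp (C t⁻¹ * X) := by
  have hC : C t⁻¹ * (X + C t) = C t⁻¹ * X + 1 := by
    rw [mul_add, ← C_mul, inv_mul_cancel₀ ht, C_1]
  have hpow : (X + C t) ^ i * (C t⁻¹ * X) ^ i = X ^ i * (C t⁻¹ * X + 1) ^ i := by
    rw [← mul_pow, ← mul_pow, ← hC]
    ring
  simp only [taylor_mul, taylor_pow, taylor_X, mul_comp, pow_comp, sub_comp, add_comp, X_comp,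
    one_comp, C_comp, map_sub, map_add, taylor_C, taylor_one, C_1, hC, add_sub_cancel_right]
  linear_combination (C α + C β * (C t⁻¹ * X + 1)) * hpow

theorem pow_apply_of_apply_eq_taylor {R M : Type*} [CommSemiring R] [AddCommMonoid M] [Module R M]
    [TopologicalSpace M] {Φ : R[X] →ₗ[R] M} {S : M →L[R] M} {r : R}
    (hS : ∀ p, S (Φ p) = Φ (taylor r p)) (n : ℕ) (p : R[X]) :
    (S ^ n) (Φ p) = Φ (taylor (n * r) p) := by
  induction n with
  | zero => simp
  | succ n ih => rw [pow_succ', mul_apply_eq_comp, ih, hS, taylor_taylor,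
      Nat.cast_succ, add_one_mul, add_comm]

variable {𝕜 E : Type*} [RCLike 𝕜] [AddCommGroup E] [Module 𝕜 E] [TopologicalSpace E]
  [ContinuousAdd E] [ContinuousSMul 𝕜 E]

theorem smul_X_pow_mem_mixingPairs {Φ : 𝕜[X] →ₗ[𝕜] E} {S : E →L[𝕜] E}
    (hS : ∀ p, S (Φ p) = Φ (taylor 1 p)) (i : ℕ) (a b : 𝕜) :
    (a • Φ (X ^ i), b • Φ (X ^ i)) ∈ mixingPairs S := by
  -- `s` vanishes to order `i` at `1`, so the translate by `n` of `X ^ i * s(X / n)` is divisible by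
  -- `X ^ i` again, with quotient `s'(X / n)`; `α` and `β` are fitted to `s(0) = a` and `s'(0) = b`.
  set α : 𝕜 := (-1) ^ i * a
  set β : 𝕜 := b - α
  set s : 𝕜[X] := (X - 1) ^ i * (C α + C β * X) with hs
  set s' : 𝕜[X] := (X + 1) ^ i * (C (α + β) + C β * X) with hs'
  have hlim : ∀ q : 𝕜[X], Tendsto (fun n : ℕ => Φ (X ^ i * q.comp (C (n : 𝕜)⁻¹ * X))) atTop
      (𝓝 (q.eval 0 • Φ (X ^ i))) := fun q => by
    have hc := (continuous_map_mul_comp_C_mul_X Φ (X ^ i) q).tendsto 0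
    rw [C_0, zero_mul, comp_zero, mul_comm, ← smul_eq_C_mul, map_smul] at hc
    exact hc.comp tendsto_inv_atTop_nhds_zero_nat
  have hs0 : s.eval 0 = a := by simp [hs, α, ← mul_assoc, ← mul_pow]
  have hs'0 : s'.eval 0 = b := by simp [hs', β]
  refine ⟨_, hs0 ▸ hlim s, (hs'0 ▸ hlim s').congr' ?_⟩
  filter_upwards [eventually_ne_atTop 0] with n hn
  rw [pow_apply_of_apply_eq_taylor hS, mul_one, taylor_X_pow_mul_comp (Nat.cast_ne_zero.2 hn)]

theorem isTopologicallyMixing_of_apply_eq_taylor {Φ : 𝕜[X] →ₗ[𝕜] E} (hΦ : DenseRange Φ)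
    {S : E →L[𝕜] E} (hS : ∀ p, S (Φ p) = Φ (taylor 1 p)) : IsTopologicallyMixing S := by
  have hdiag : ∀ (a b : 𝕜) (p : 𝕜[X]), (a • Φ p, b • Φ p) ∈ mixingPairs S := fun a b p => by
    induction p using Polynomial.induction_on' with
    | add p q hp hq => simpa only [map_add, smul_add, Prod.mk_add_mk] using add_mem hp hq
    | monomial i c =>
      simpa only [← smul_X_eq_monomial, map_smul, mul_smul]
        using smul_X_pow_mem_mixingPairs hS i (a * c) (b * c)
  refine isTopologicallyMixing_of_dense_mixingPairs ((hΦ.prodMap hΦ).mono ?_)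
  rintro - ⟨⟨p, q⟩, rfl⟩
  simpa using add_mem (hdiag 1 0 p) (hdiag 0 1 q)

end Mixing

section DifferenceOperator

theorem degree_taylor_one_X_pow_sub {R : Type*} [CommRing R] [CharZero R] (n : ℕ) :
    (taylor 1 (X ^ (n + 1)) - X ^ (n + 1) : R[X]).degree = n := by
  have hcoeff : ∀ m, (taylor 1 (X ^ (n + 1)) - X ^ (n + 1) : R[X]).coeff m =
      (n + 1).choose m - if m = n + 1 then 1 else 0 := fun m => by
    rw [coeff_sub, taylor_pow, taylor_X, C_1, coeff_X_add_one_pow, coeff_X_pow]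
  refine degree_eq_of_le_of_coeff_ne_zero ((degree_le_iff_coeff_zero _ _).2 fun m hm => ?_) ?_
  · rcases (Nat.succ_le_of_lt (Nat.cast_lt.1 hm)).eq_or_lt with rfl | hm
    · rw [hcoeff, Nat.choose_self, if_pos rfl, Nat.cast_one, sub_self]
    · rw [hcoeff, Nat.choose_eq_zero_of_lt hm, if_neg hm.ne', Nat.cast_zero, sub_zero]
  · rw [hcoeff, Nat.choose_succ_self_right, if_neg n.lt_succ_self.ne, sub_zero]
    exact Nat.cast_ne_zero.2 n.succ_ne_zero

theorem linearIndependent_sumElim_X_pow_map {K : Type*} [Field K] {L : K[X] →ₗ[K] K[X]}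
    (hL : ∀ n : ℕ, (L (X ^ (n + 1))).degree = n) :
    LinearIndependent K (Sum.elim (fun k : ℕ => (X ^ (2 * k + 1) : K[X]))
      fun k => L (X ^ (2 * k + 1))) := by
  let Q : Polynomial.Sequence K :=
    { elems' := fun n => if Even n then L (X ^ (n + 1)) else X ^ n
      degree_eq' := fun n => by
        split_ifs
        exacts [hL n, degree_X_pow n] }
  have hinj : Function.Injective (Sum.elim (fun k : ℕ => 2 * k + 1) fun k => 2 * k) :=
    Function.Injective.sumElim (fun _ _ h => by lia) (fun _ _ h => by lia) fun _ _ => by lia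
  convert! Q.linearIndependent.comp _ hinj using 1
  have heven : ∀ k, Q (2 * k) = L (X ^ (2 * k + 1)) := fun k => if_pos (even_two_mul k)
  have hodd : ∀ k, Q (2 * k + 1) = X ^ (2 * k + 1) := fun k =>
    if_neg (Nat.not_even_two_mul_add_one k)
  ext1 (k | k) <;> simp [heven, hodd]

theorem exists_isTopologicallyMixing_linearIndependent {𝕜 E : Type*} [RCLike 𝕜]
    [NormedAddCommGroup E] [NormedSpace 𝕜 E] [CompleteSpace E] [TopologicalSpace.SeparableSpace E]
    (hE : ¬ FiniteDimensional 𝕜 E) :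
    ∃ (S : E →L[𝕜] E) (u : ℕ → E), IsTopologicallyMixing S ∧
      LinearIndependent 𝕜 (Sum.elim u fun k => S (u k) - u k) := by
  set L : 𝕜[X] →ₗ[𝕜] 𝕜[X] := taylor 1 - LinearMap.id
  have hL : ∀ n : ℕ, (L (X ^ (n + 1))).degree = n := degree_taylor_one_X_pow_sub
  have hlt : ∀ k : ℕ, (L (X ^ k)).degree < k := by
    rintro (_ | n)
    · simp [L]
    · rw [hL]
      exact_mod_cast n.lt_succ_self
  obtain ⟨Φ, D, hΦ, hd, hD⟩ := exists_clm_extending_degree_lowering hE hlt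
  refine ⟨1 + D, fun k => Φ (X ^ (2 * k + 1)),
    isTopologicallyMixing_of_apply_eq_taylor hd fun p => by simp [hD, L], ?_⟩
  convert! (linearIndependent_sumElim_X_pow_map hL).map' Φ (LinearMap.ker_eq_bot.2 hΦ) using 1
  ext1 (k | k) <;> simp [hD]

end DifferenceOperator

section StrongOperatorTopology

variable {𝕜 E : Type*} [NontriviallyNormedField 𝕜] [NormedAddCommGroup E] [NormedSpace 𝕜 E]

theorem IsSOTDense.of_subset_closure {s t : Set (E →L[𝕜] E)} (hs : IsSOTDense s)
    (hst : s ⊆ closure t) : IsSOTDense t :=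
  Dense.of_closure <| hs.mono <| (Set.image_mono hst).trans <|
    image_closure_subset_closure_image (map_continuous _)

theorem isSOTDense_of_dense_eqOn {s : Set (E →L[𝕜] E)}
    (hs : ∀ F : Set E, F.Finite → Dense {R : E →L[𝕜] E | ∃ S ∈ s, Set.EqOn S R F}) :
    IsSOTDense s := by
  intro R
  rw [mem_closure_iff_nhds]
  intro V hV
  rw [(PointwiseConvergenceCLM.isEmbedding_coeFn (RingHom.id 𝕜) E E).nhds_eq_comap, nhds_pi] at hV
  obtain ⟨W, hW, hWV⟩ := hV
  obtain ⟨F, hF, t, ht, htW⟩ := Filter.mem_pi.1 hW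
  have hnear : ∀ᶠ R' : E →L[𝕜] E in 𝓝 R, ∀ x ∈ F, R' x ∈ t x :=
    (eventually_all_finite hF).2 fun x _ =>
      (continuous_eval_const x).continuousAt.eventually_mem (ht x)
  obtain ⟨R', ⟨S, hS, hSR'⟩, hR'⟩ := (hs F hF).inter_nhds_nonempty hnear
  exact ⟨_, hWV (htW fun x hx => (hSR' hx).symm ▸ hR' x hx), S, hS, rfl⟩

end StrongOperatorTopology

section SimilarityOrbit

theorem exists_linearEquiv_apply_eq {K V ι : Type*} [DivisionRing K] [AddCommGroup V] [Module K V]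
    [FiniteDimensional K V] {a b : ι → V} (ha : LinearIndependent K a)
    (hb : LinearIndependent K b) : ∃ g : V ≃ₗ[K] V, ∀ i, g (a i) = b i := by
  obtain ⟨g, hg⟩ := Submodule.exists_linearEquiv_restrict_eq
    (ha.linearCombinationEquiv.symm ≪≫ₗ hb.linearCombinationEquiv)
  refine ⟨g, fun i => ?_⟩
  have hai : ha.linearCombinationEquiv (Finsupp.single i 1) = a i := by simp
  rw [← hai, ← hg]
  simp

theorem exists_unit_extending {R M : Type*} [Ring R] [AddCommGroup M] [Module R M]
    [TopologicalSpace M] [IsTopologicalAddGroup M] {W : Submodule R M} (hW : W.ClosedComplemented)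
    (g : W ≃L[R] W) : ∃ K : (M →L[R] M)ˣ, ∀ x : W, (K : M →L[R] M) x = g x := by
  obtain ⟨P, hP⟩ := hW
  let extend : (W →L[R] W) → M →L[R] M := fun h => 1 + W.subtypeL ∘L (h - 1) ∘L P
  have hextend : ∀ h h' : W →L[R] W, h * h' = 1 → extend h * extend h' = 1 := fun h h' hh' => by
    have hh'P : ∀ x, h (h' (P x)) = P x := fun x => DFunLike.congr_fun hh' (P x)
    ext x
    simp [extend, hP, hh'P]
    abel
  exact ⟨⟨extend g, extend g.symm, hextend _ _ (by ext; simp), hextend _ _ (by ext; simp)⟩,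
    fun x => by simp [extend, hP]⟩

variable {𝕜 E : Type*} [RCLike 𝕜] [NormedAddCommGroup E] [NormedSpace 𝕜 E]

theorem exists_unit_apply_eq {ι : Type*} [Finite ι] {a b : ι → E} (ha : LinearIndependent 𝕜 a)
    (hb : LinearIndependent 𝕜 b) : ∃ K : (E →L[𝕜] E)ˣ, ∀ i, (K : E →L[𝕜] E) (a i) = b i := by
  set W := Submodule.span 𝕜 (Set.range a ∪ Set.range b)
  have : FiniteDimensional 𝕜 W :=
    .span_of_finite 𝕜 ((Set.finite_range a).union (Set.finite_range b))
  have haW : ∀ i, a i ∈ W := fun i => Submodule.subset_span (.inl ⟨i, rfl⟩)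
  have hbW : ∀ i, b i ∈ W := fun i => Submodule.subset_span (.inr ⟨i, rfl⟩)
  obtain ⟨g, hg⟩ := exists_linearEquiv_apply_eq (V := W)
    (a := fun i => ⟨a i, haW i⟩) (b := fun i => ⟨b i, hbW i⟩)
    (.of_comp W.subtype ha) (.of_comp W.subtype hb)
  obtain ⟨K, hK⟩ := exists_unit_extending (.of_finiteDimensional W) g.toContinuousLinearEquiv
  exact ⟨K, fun i => by simpa [hg] using hK ⟨a i, haW i⟩⟩

theorem exists_linearIndependent_mkQ_comp {K V ι : Type*} [DivisionRing K] [AddCommGroup V]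
    [Module K V] [Finite ι] (hV : ¬ FiniteDimensional K V) (W : Submodule K V)
    [FiniteDimensional K W] : ∃ w : ι → V, LinearIndependent K (W.mkQ ∘ w) := by
  have hQ : ¬ FiniteDimensional K (V ⧸ W) := fun _ => hV (.of_submodule_quotient W)
  have hrank : (Nat.card ι : Cardinal) ≤ Module.rank K (V ⧸ W) :=
    Cardinal.natCast_lt_aleph0.le.trans (not_lt.1 fun h => hQ (Module.rank_lt_aleph0_iff.1 h))
  obtain ⟨q, hq⟩ := exists_linearIndependent_of_le_rank hrank
  choose w hw using fun i => W.mkQ_surjective (q (Finite.equivFin ι i))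
  exact ⟨w, by simpa [Function.comp_def, hw] using! hq.comp _ (Finite.equivFin ι).injective⟩

theorem dense_setOf_linearIndependent_sumElim (hE : ¬ FiniteDimensional 𝕜 E) {ι : Type*} [Finite ι]
    {y : ι → E} (hy : LinearIndependent 𝕜 y) :
    Dense {R : E →L[𝕜] E | LinearIndependent 𝕜 (Sum.elim y (R ∘ y))} := by
  intro R
  set W := Submodule.span 𝕜 (Set.range y ∪ Set.range (R ∘ y))
  have : FiniteDimensional 𝕜 W :=
    .span_of_finite 𝕜 ((Set.finite_range y).union (Set.finite_range _))
  have hyW : ∀ i, y i ∈ W := fun i => Submodule.subset_span (.inl ⟨i, rfl⟩)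
  have hRyW : ∀ i, R (y i) ∈ W := fun i => Submodule.subset_span (.inr ⟨i, rfl⟩)
  obtain ⟨w, hw⟩ := exists_linearIndependent_mkQ_comp (ι := ι) hE W
  obtain ⟨B, hB⟩ := exists_clm_apply_eq hy w
  have hli : ∀ t : 𝕜, t ≠ 0 → LinearIndependent 𝕜 (Sum.elim y ((R + t • B) ∘ y)) := fun t ht => by
    refine LinearIndependent.sumElim_of_quotient (M' := W) (f := fun i => ⟨y i, hyW i⟩)
      (.of_comp W.subtype hy) _ ?_
    have hmkQ : W.mkQ ∘ ((R + t • B) ∘ y) = t • (W.mkQ ∘ w) := by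
      ext i
      simp [hB, (Submodule.Quotient.mk_eq_zero W).2 (hRyW i)]
    exact hmkQ ▸ hw.units_smul fun _ => Units.mk0 t ht
  have hlim : Tendsto (fun t : 𝕜 => R + t • B) (𝓝[≠] 0) (𝓝 R) := by
    have hc : Continuous fun t : 𝕜 => R + t • B := by fun_prop
    simpa using (hc.tendsto 0).mono_left nhdsWithin_le_nhds
  exact mem_closure_of_tendsto hlim (eventually_mem_nhdsWithin.mono hli)

theorem isSOTDense_range_conj (hE : ¬ FiniteDimensional 𝕜 E) {S : E →L[𝕜] E} {u : ℕ → E}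
    (hu : LinearIndependent 𝕜 (Sum.elim u fun k => S (u k) - u k)) :
    IsSOTDense (Set.range fun K : (E →L[𝕜] E)ˣ => (↑K⁻¹ * S * K : E →L[𝕜] E)) := by
  refine isSOTDense_of_dense_eqOn fun F hF => ?_
  have : FiniteDimensional 𝕜 (Submodule.span 𝕜 F) := .span_of_finite 𝕜 hF
  set y := Module.finBasis 𝕜 (Submodule.span 𝕜 F)
  have hy : LinearIndependent 𝕜 fun i => (y i : E) :=
    y.linearIndependent.map' _ (Submodule.ker_subtype _)
  refine ((dense_setOf_linearIndependent_sumElim hE hy).preimage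
    (Homeomorph.subRight (1 : E →L[𝕜] E)).isOpenMap).mono fun R hR => ?_
  obtain ⟨K, hK⟩ := exists_unit_apply_eq (hu.comp _ (Fin.val_injective.sumMap Fin.val_injective)) hR
  have hKu : ∀ i : Fin _, (K : E →L[𝕜] E) (u i) = y i := fun i => hK (.inl i)
  have hKSu : ∀ i : Fin _, (K : E →L[𝕜] E) (S (u i)) = R (y i) := fun i => by
    simpa [hKu] using hK (.inr i)
  have hKy : ∀ i, (↑K⁻¹ : E →L[𝕜] E) (y i) = u i := fun i => by
    rw [← hKu, ← mul_apply_eq_comp, K.inv_mul, one_apply_eq_self]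
  have hspan : (K * S * ↑K⁻¹ : E →L[𝕜] E).toLinearMap ∘ₗ (Submodule.span 𝕜 F).subtype =
      R.toLinearMap ∘ₗ (Submodule.span 𝕜 F).subtype := y.ext fun i => by simp [hKy, hKSu]
  exact ⟨K * S * ↑K⁻¹, ⟨K⁻¹, by simp⟩, fun x hx =>
    LinearMap.congr_fun hspan ⟨x, Submodule.subset_span hx⟩⟩

end SimilarityOrbit

section Recurrence

theorem mapClusterPt_of_range_subset_closure_range {α β : Type*} [TopologicalSpace α]
    [∀ x : α, (𝓝[≠] x).NeBot] [TopologicalSpace β] [T1Space β] {g : α → β} (hg : Continuous g)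
    (hinj : Function.Injective g) {u : ℕ → β} (hu : Set.range g ⊆ closure (Set.range u)) (x : α) :
    MapClusterPt (g x) atTop u := by
  have : T1Space α := t1Space_of_injective_of_continuous hinj hg
  refine mapClusterPt_atTop_iff_forall_mem_closure.2 fun n => ?_
  have hfin : (u '' Set.Iio n).Finite := (Set.finite_Iio n).image u
  have hsplit : closure (Set.range u) = u '' Set.Iio n ∪ closure (u '' Set.Ici n) := by
    rw [← hfin.isClosed.closure_eq, ← closure_union, ← Set.image_union, Set.Iio_union_Ici,
      Set.image_univ]
  have hdense : Dense (g ⁻¹' (u '' Set.Iio n))ᶜ := by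
    rw [Set.compl_eq_univ_sdiff]
    exact dense_univ.sdiff_finite (hfin.preimage hinj.injOn)
  refine hdense.induction (fun y hy => ?_) (isClosed_closure.preimage hg) x
  exact (hsplit ▸ hu ⟨y, rfl⟩).resolve_left hy

theorem mapClusterPt_of_mem_sHC {𝕜 E : Type*} [NontriviallyNormedField 𝕜] [NormedAddCommGroup E]
    [NormedSpace 𝕜 E] [Nontrivial E] {N : ℕ} {T : Fin N → E →L[𝕜] E} {f : E} (hf : f ∈ sHC T)
    (x : E) : MapClusterPt (fun _ => x) atTop fun n i => (T i ^ n) f := by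
  rcases isEmpty_or_nonempty (Fin N) with _ | _
  · exact mapClusterPt_iff_frequently.2 fun s hs => .of_forall fun n => by
      convert! mem_of_mem_nhds hs
  · have := Module.punctured_nhds_neBot 𝕜 E
    exact mapClusterPt_of_range_subset_closure_range (g := fun x _ => x) (by fun_prop)
      Function.const_injective hf x

end Recurrence

section GenericSimilarity

variable {𝕜 E : Type*} [RCLike 𝕜] [NormedAddCommGroup E] [NormedSpace 𝕜 E]

theorem dense_setOf_exists_dist_lt {S : E →L[𝕜] E} (hS : IsTopologicallyMixing S) {P : ℕ → Prop}
    (hP : ∃ᶠ n in atTop, P n) {f : E} (hf : f ≠ 0) (x : E) {ε : ℝ} (hε : 0 < ε) :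
    Dense {L : E →L[𝕜] E | ∃ n, P n ∧ dist ((S ^ n) (L f)) (L x) < ε} := by
  intro L
  refine mem_closure_iff.2 fun V hV hLV => ?_
  obtain ⟨φ, hφ⟩ := SeparatingDual.exists_eq_one (R := 𝕜) hf
  set G : E → E →L[𝕜] E := fun w => L + φ.smulRight (w - L f)
  have hG : Continuous G := by fun_prop
  have hGL : G (L f) = L := by simp [G]
  have hGf : ∀ w, G w f = w := fun w => by simp [G, hφ]
  set U : Set E := G ⁻¹' (V ∩ {R | dist (L x) (R x) < ε / 2})
  have hU : IsOpen U := (hV.inter (isOpen_lt (by fun_prop) continuous_const)).preimage hG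
  have hLU : L f ∈ U := by simpa [U, hGL] using ⟨hLV, hε⟩
  obtain ⟨n, hn, w, ⟨hwV, hw⟩, hSw⟩ := (hP.and_eventually <|
    hS hU ⟨_, hLU⟩ Metric.isOpen_ball ⟨L x, Metric.mem_ball_self (half_pos hε)⟩).exists
  refine ⟨G w, hwV, n, hn, ?_⟩
  rw [hGf, FunLike.coe_pow_eq_iterate]
  exact (dist_triangle _ (L x) _).trans_lt (by linarith [Metric.mem_ball.1 hSw, hw.out])

theorem eventually_residual_mem_closure {β : Type*} [PseudoMetricSpace β] {S : E →L[𝕜] E}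
    (hS : IsTopologicallyMixing S) {v : ℕ → β} {b : β} (hv : MapClusterPt b atTop v) {f : E}
    (hf : f ≠ 0) (x : E) : ∀ᶠ L : E →L[𝕜] E in residual _,
      (b, L x) ∈ closure (Set.range fun n => (v n, (S ^ n) (L f))) := by
  have happrox : ∀ l : ℕ, ∀ᶠ L : E →L[𝕜] E in residual _, ∃ n, dist b (v n) < 1 / ((l : ℝ) + 1) ∧
      dist ((S ^ n) (L f)) (L x) < 1 / ((l : ℝ) + 1) := fun l => by
    refine residual_of_dense_open ?_ (dense_setOf_exists_dist_lt hS ?_ hf x (by positivity))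
    · simp only [Set.ofPred_exists, Set.ofPred_and]
      exact isOpen_iUnion fun n =>
        isOpen_const.inter (isOpen_lt (by fun_prop) continuous_const)
    · simp only [dist_comm b]
      exact hv.frequently (Metric.ball_mem_nhds b (by positivity))
  filter_upwards [eventually_countable_forall.2 happrox] with L hL
  refine Metric.mem_closure_range_iff.2 fun ε hε => ?_
  obtain ⟨l, hl⟩ := exists_nat_one_div_lt hε
  obtain ⟨n, hbn, hSn⟩ := hL l
  exact ⟨n, max_lt (hbn.trans hl) ((dist_comm _ _).trans_lt (hSn.trans hl))⟩

/-- The operators `L` such that, for every `x`, the joint orbit of `f` under the `T i` and of `L f`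
under `S` accumulates at `(x, …, x, L x)`. For invertible `L` this says that `f` is s-hypercyclic
for `T` extended by `L⁻¹ S L`; stated without the inverse, it makes sense for every `L`. -/
def orbitTransfers {N : ℕ} (T : Fin N → E →L[𝕜] E) (S : E →L[𝕜] E) (f : E) : Set (E →L[𝕜] E) :=
  {L | ∀ x, ((fun _ : Fin N => x), L x) ∈
    closure (Set.range fun n : ℕ => ((fun i => (T i ^ n) f), (S ^ n) (L f)))}

theorem orbitTransfers_mem_residual [TopologicalSpace.SeparableSpace E] {N : ℕ}
    {T : Fin N → E →L[𝕜] E} {S : E →L[𝕜] E} (hS : IsTopologicallyMixing S) {f : E}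
    (hf : f ∈ sHC T) (hf₀ : f ≠ 0) : orbitTransfers T S f ∈ residual (E →L[𝕜] E) := by
  have : Nontrivial E := ⟨f, 0, hf₀⟩
  filter_upwards [eventually_countable_forall.2 fun k => eventually_residual_mem_closure hS
    (mapClusterPt_of_mem_sHC hf (TopologicalSpace.denseSeq E k)) hf₀ _] with L hL x
  refine (TopologicalSpace.denseRange_denseSeq E).induction_on x ?_ hL
  exact isClosed_closure.preimage (by fun_prop)

theorem mem_sHC_snoc_of_mem_orbitTransfers {N : ℕ} {T : Fin N → E →L[𝕜] E} {S : E →L[𝕜] E} {f : E}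
    {L : (E →L[𝕜] E)ˣ} (hL : ↑L ∈ orbitTransfers T S f) :
    f ∈ sHC (Fin.snoc T (↑L⁻¹ * S * L) : Fin (N + 1) → E →L[𝕜] E) := by
  rintro - ⟨x, rfl⟩
  have hinv : ∀ y, (↑L⁻¹ : E →L[𝕜] E) ((L : E →L[𝕜] E) y) = y := fun y => by
    rw [← mul_apply_eq_comp, L.inv_mul, one_apply_eq_self]
  have hpow : ∀ n : ℕ, (↑L⁻¹ * S * L : E →L[𝕜] E) ^ n = ↑L⁻¹ * S ^ n * L := fun n => by
    simpa using L⁻¹.conj_pow S n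
  have hcont : Continuous fun z : (Fin N → E) × E =>
      (Fin.snoc z.1 ((↑L⁻¹ : E →L[𝕜] E) z.2) : Fin (N + 1) → E) :=
    Continuous.finSnoc (A := fun _ => E) continuous_fst (by fun_prop)
  convert map_mem_closure hcont (hL x) ?_ using 1
  · ext i
    induction i using Fin.lastCases <;> simp [hinv]
  · rintro - ⟨n, rfl⟩
    refine ⟨n, ?_⟩
    ext i
    induction i using Fin.lastCases <;> simp [hpow]

theorem range_conj_subset_closure_image {R : Type*} [NormedRing R] [HasSummableGeomSeries R]
    {G : Set R} (hG : Dense G) (s : R) :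
    (Set.range fun u : Rˣ => ↑u⁻¹ * s * u) ⊆
      closure ((fun u : Rˣ => ↑u⁻¹ * s * u) '' (Units.val ⁻¹' G)) :=
  Continuous.range_subset_closure_image_dense (by fun_prop)
    (hG.preimage Units.isOpenEmbedding_val.isOpenMap)

end GenericSimilarity

theorem corollary2p6_general {𝕜 X : Type*} [RCLike 𝕜] [NormedAddCommGroup X] [NormedSpace 𝕜 X]
    [CompleteSpace X] [TopologicalSpace.SeparableSpace X] (hX : ¬ FiniteDimensional 𝕜 X)
    {N : ℕ} {T : Fin N → X →L[𝕜] X} {A : Set X} (hA : A ⊆ sHC T) (hAc : A.Countable)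
    (hA₀ : (0 : X) ∉ A) :
    IsSOTDense {S : X →L[𝕜] X | A ⊆ sHC (Fin.snoc T S : Fin (N + 1) → X →L[𝕜] X)} := by
  obtain ⟨S, u, hS, hu⟩ := exists_isTopologicallyMixing_linearIndependent hX
  have hdense : Dense (⋂ f ∈ A, orbitTransfers T S f) :=
    dense_of_mem_residual <| (countable_bInter_mem hAc).2 fun f hf =>
      orbitTransfers_mem_residual hS (hA hf) (ne_of_mem_of_not_mem hf hA₀)
  refine (isSOTDense_range_conj hX hu).of_subset_closure
    ((range_conj_subset_closure_image hdense S).trans (closure_mono ?_))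
  rintro - ⟨L, hL, rfl⟩ f hf
  exact mem_sHC_snoc_of_mem_orbitTransfers (Set.mem_iInter₂.1 hL f hf)

theorem corollary2p6 {𝕜 X : Type*} [RCLike 𝕜] [NormedAddCommGroup X] [NormedSpace 𝕜 X]
    [CompleteSpace X] [TopologicalSpace.SeparableSpace X] (hX : ¬ FiniteDimensional 𝕜 X)
    (N : ℕ) (hN : 1 ≤ N) (T : Fin N → X →L[𝕜] X) (hT : IsSHypercyclic T)
    (A : Set X) (hA : A ⊆ sHC T) (hAc : A.Countable)
    (hAi : LinearIndependent 𝕜 ((↑) : A → X)) :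
    IsSOTDense {S : X →L[𝕜] X | A ⊆ sHC (Fin.snoc T S : Fin (N + 1) → X →L[𝕜] X)} :=
  corollary2p6_general hX hA hAc fun h => hAi.ne_zero ⟨0, h⟩ rfl
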